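/- Let $d\ge 1$, let $Q\in\mathbb{R}^{d\times d}$ have nonnegative off-diagonal entries and zero column sums ($Q_{ij}$, $i\ne j$, is the intensity of a transition from state $j$ to state $i$), and let $\lambda\in\mathbb{R}^d$ have nonnegative entries. Let $(\Omega,\mathcal{F},\mathbb{P})$ be a probability space with a filtration $(\mathcal{F}_t)_{t\ge0}$. Let $X$ be an adapted càdlàg process with values in the set $\{e_1,\dots,e_d\}$ of standard basis vectors of $\mathbb{R}^d$ which is a Markov chain with intensity matrix $Q$ relative to $(\mathcal{F}_t)$, in the sense that $X_t-\int_0^t QX_r\,\mathrm{d}r$ is an $(\mathcal{F}_t)$-martingale. Let $N$ be a Markov-modulated Poisson process with intensity $\lambda^\top X_t$, i.e. an adapted counting process ($N_0=0$, $\mathbb{N}$-valued, nondecreasing, càdlàg, with jumps of size one) such that $N_t-\int_0^t\lambda^\top X_r\,\mathrm{d}r$ is an $(\mathcal{F}_t)$-martingale, and suppose that almost surely $X$ and $N$ have no simultaneous jumps. Then for all $u\in\mathbb{R}$ and $0\le s\le t$ the $\mathbb{C}^d$-valued random vector $e^{\mathrm{i}uN_t}X_t$ is integrable and, almost surely, $$\mathbb{E}\big[e^{\mathrm{i}uN_t}X_t\,\big|\,\mathcal{F}_s\big]=\exp\Big(\big((e^{\mathrm{i}u}-1)\,\mathrm{diag}(\lambda)+Q\big)(t-s)\Big)\,e^{\mathrm{i}uN_s}X_s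 .$$ -/

import Mathlib

open MeasureTheory Filter Topology
open scoped NNReal Matrix

noncomputable section

/-- Càdlàg path on `[0, ∞)`: right-continuous, with left limits. -/
def IsCadlagPath {E : Type*} [TopologicalSpace E] (f : ℝ≥0 → E) : Prop :=
  (∀ t, ContinuousWithinAt f (Set.Ici t) t) ∧
    ∀ t, ∃ y, Tendsto f (𝓝[<] t) (𝓝 y)

/-- `f` jumps at time `t`: its value differs from its left limit `f (t-)`
(with `f (0-) = f 0`, so there is no jump at time `0`). -/
def JumpsAt {E : Type*} [TopologicalSpace E] (f : ℝ≥0 → E) (t : ℝ≥0) : Prop :=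
  Function.leftLim f t ≠ f t

/-- Path of a counting process: it starts at `0`, is nondecreasing and right-continuous,
and all its jumps have size one. -/
structure IsCountingPath (n : ℝ≥0 → ℕ) : Prop where
  zero : n 0 = 0
  mono : Monotone n
  cadlag : IsCadlagPath n
  unit_jumps : ∀ t, JumpsAt n t → n t = Function.leftLim n t + 1

/-- Transition intensity matrix of a Markov chain, in the column convention: for `i ≠ j`
the entry `Q i j` is the intensity of a transition from `j` to `i`, and column sums vanish. -/
structure IsIntensityMatrix {d : ℕ} (Q : Matrix (Fin d) (Fin d) ℝ) : Prop where
  off_diag_nonneg : ∀ i j, i ≠ j → 0 ≤ Q i j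
  col_sum : ∀ j, ∑ i, Q i j = 0

/-- `X` is, relative to the filtration `𝓕`, a continuous-time Markov chain on the standard
basis vectors of `ℝ^d` with intensity matrix `Q` (martingale problem): it is adapted, has
càdlàg paths, and `dX_t = Q X_t dt + dM_t` with `M` an `𝓕`-martingale. -/
structure IsMarkovChain {Ω : Type*} {mΩ : MeasurableSpace Ω} (μ : Measure Ω)
    (𝓕 : Filtration ℝ≥0 mΩ) {d : ℕ} (Q : Matrix (Fin d) (Fin d) ℝ)
    (X : ℝ≥0 → Ω → Fin d → ℝ) : Prop where
  intensity : IsIntensityMatrix Q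
  basis_valued : ∀ t ω, ∃ i, X t ω = Pi.single i 1
  adapted : ∀ t, Measurable[𝓕 t] (X t)
  cadlag : ∀ ω, IsCadlagPath fun t => X t ω
  martingale :
    Martingale (fun t ω => X t ω - ∫ r in (0 : ℝ)..t, Q *ᵥ X r.toNNReal ω) 𝓕 μ

/-- `N` is, relative to `𝓕`, a Markov-modulated Poisson process with intensity `lᵀ X_t`,
driven by the Markov chain `X` with intensity matrix `Q`: an adapted counting process with
`dN_t = lᵀ X_t dt + dm_t` for an `𝓕`-martingale `m`, such that almost surely `X` and `N`
have no simultaneous jumps. -/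
structure IsMMPoissonProcess {Ω : Type*} {mΩ : MeasurableSpace Ω} (μ : Measure Ω)
    (𝓕 : Filtration ℝ≥0 mΩ) {d : ℕ} (Q : Matrix (Fin d) (Fin d) ℝ) (l : Fin d → ℝ)
    (X : ℝ≥0 → Ω → Fin d → ℝ) (N : ℝ≥0 → Ω → ℕ) : Prop where
  chain : IsMarkovChain μ 𝓕 Q X
  rate_nonneg : ∀ i, 0 ≤ l i
  counting : ∀ ω, IsCountingPath fun t => N t ω
  adapted : ∀ t, Measurable[𝓕 t] (N t)
  martingale :
    Martingale (fun t ω => (N t ω : ℝ) - ∫ r in (0 : ℝ)..t, l ⬝ᵥ X r.toNNReal ω) 𝓕 μ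
  no_common_jumps :
    ∀ᵐ ω ∂μ, ∀ t, ¬ (JumpsAt (fun r => X r ω) t ∧ JumpsAt (fun r => N r ω) t)

/-- The random vector `exp (i u N_t) X_t` in `ℂ^d`. -/
def charVec {Ω : Type*} {d : ℕ} (u : ℝ) (X : ℝ≥0 → Ω → Fin d → ℝ) (N : ℝ≥0 → Ω → ℕ)
    (t : ℝ≥0) (ω : Ω) : Fin d → ℂ :=
  fun j => Complex.exp (Complex.I * u * N t ω) * (X t ω j : ℂ)

/-- The matrix `(e^{iu} - 1) diag(l) + Q`. -/
def charGenerator {d : ℕ} (u : ℝ) (Q : Matrix (Fin d) (Fin d) ℝ) (l : Fin d → ℝ) :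
    Matrix (Fin d) (Fin d) ℂ :=
  (Complex.exp (Complex.I * u) - 1) • Matrix.diagonal (fun j => (l j : ℂ)) +
    Q.map (fun x => (x : ℂ))

end

/-! Write `Z` for `charVec` and `G` for `charGenerator`. No Itô formula is needed: over `[a, b]`,
pure algebra (`charVec_sub_eq`) splits the increment of `Z` into `(b - a) G Z_a`, a term linear in
the increments of the two compensated martingales with bounded `𝓕 a`-measurable coefficients, and an
error. The martingale term integrates to zero over every `A` in `𝓕 a`, so for `A` in `𝓕 s` the
function `g r = ∫_A Z_r` solves `g' = G g` on `[s, t]` up to integrated errors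
(`setIntegral_charVec_sub`).

Summed along uniform partitions, these errors vanish in the limit. A short interval without jumps
contributes nothing. One around a single jump time contributes only `O(b - a)`: `N` moves by at most
one and not together with `X`, so the jump part of the expansion is exact (`jumpError_eq_zero`). By
compactness the number of such intervals is bounded along each path (`tendsto_sum_partition_zero`),
and domination by a multiple of `N_t` plus a constant carries the limit through the expectation. A
telescoping argument (`eq_exp_smul_mulVec_of_tendsto_sum`) then gives `g t = exp((t - s) G) g s` for
all `A` in `𝓕 s`, which characterises the conditional expectation. -/

/-! ### Regularity of càdlàg paths -/

theorem measurable_of_continuousWithinAt_Ici {E : Type*} [TopologicalSpace E]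
    [TopologicalSpace.PseudoMetrizableSpace E] [MeasurableSpace E] [BorelSpace E] {f : ℝ≥0 → E}
    (hf : ∀ t, ContinuousWithinAt f (Set.Ici t) t) : Measurable f := by
  -- Grid points of mesh `1 / (m + 1)` lying to the right of `t`, so that right-continuity applies
  -- along them; `f ∘ q m` factors through `ℕ` and is thus measurable.
  let q : ℕ → ℝ≥0 → ℝ≥0 := fun m t => ((⌊((m : ℝ≥0) + 1) * t⌋₊ : ℝ≥0) + 1) / ((m : ℝ≥0) + 1)
  have hq_lower (m : ℕ) (t : ℝ≥0) : t ≤ q m t := by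
    rw [le_div_iff₀ (by positivity), mul_comm]
    exact (Nat.lt_floor_add_one _).le
  have hq_upper (m : ℕ) (t : ℝ≥0) : q m t ≤ t + 1 / ((m : ℝ≥0) + 1) := by
    have hne : (m : ℝ≥0) + 1 ≠ 0 := by positivity
    rw [div_le_iff₀ (by positivity), add_mul t, div_mul_cancel₀ _ hne, mul_comm t]
    gcongr
    exact Nat.floor_le zero_le
  refine measurable_of_tendsto_metrizable (f := fun m t => f (q m t)) (fun m => ?_) ?_
  · have h1 : Measurable fun k : ℕ => f (((k : ℝ≥0) + 1) / ((m : ℝ≥0) + 1)) := measurable_from_nat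
    exact h1.comp (Nat.measurable_floor.comp (measurable_const.mul measurable_id))
  · rw [tendsto_pi_nhds]
    intro t
    refine (hf t).tendsto.comp (tendsto_nhdsWithin_iff.2 ⟨?_, Eventually.of_forall (hq_lower · t)⟩)
    refine tendsto_of_tendsto_of_tendsto_of_le_of_le tendsto_const_nhds ?_ (hq_lower · t)
      (hq_upper · t)
    have : Tendsto (fun m : ℕ => 1 / ((m : ℝ≥0) + 1)) atTop (𝓝 0) := by
      rw [← NNReal.tendsto_coe]
      simpa using tendsto_one_div_add_atTop_nhds_zero_nat (𝕜 := ℝ)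
    simpa using tendsto_const_nhds.add this

theorem Filter.Tendsto.eventually_eq_of_finite {α E : Type*} [TopologicalSpace E] [T1Space E]
    {F : Filter α} {f : α → E} {y : E} {S : Set E} (hf : Tendsto f F (𝓝 y)) (hS : S.Finite)
    (hfS : ∀ r, f r ∈ S) : ∀ᶠ r in F, f r = y := by
  have hU : (S \ {y})ᶜ ∈ 𝓝 y := (hS.subset Set.sdiff_subset).isClosed.isOpen_compl.mem_nhds (by simp)
  filter_upwards [hf hU] with r hr
  by_contra hne
  exact hr ⟨hfS r, hne⟩

/-- Around each time, the pair of paths is constant before and from that time on, and changes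
there at most in one component, the counting path by at most one. -/
theorem eventually_constant_pair {d : ℕ} {x : ℝ≥0 → Fin d → ℝ} {n : ℝ≥0 → ℕ}
    (hx : ∀ t, ∃ i, x t = Pi.single i 1) (hxc : IsCadlagPath x) (hn : IsCountingPath n)
    {τ : ℝ≥0} (hj : ¬ (JumpsAt x τ ∧ JumpsAt n τ)) :
    ∃ (x₀ : Fin d → ℝ) (n₀ : ℕ),
      (∀ᶠ r in 𝓝 τ, (r < τ → x r = x₀ ∧ n r = n₀) ∧ (τ ≤ r → x r = x τ ∧ n r = n τ)) ∧
      (x₀ = x τ ∨ n₀ = n τ) ∧ (n τ = n₀ ∨ n τ = n₀ + 1) := by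
  have hS : (Set.range fun i : Fin d => (Pi.single i 1 : Fin d → ℝ)).Finite := Set.finite_range _
  have hxS : ∀ t, x t ∈ Set.range fun i : Fin d => (Pi.single i 1 : Fin d → ℝ) := fun t =>
    let ⟨i, hi⟩ := hx t; ⟨i, hi.symm⟩
  have h1 := (tendsto_leftLim_of_tendsto (hxc.2 τ)).eventually_eq_of_finite hS hxS
  have h2 := (hxc.1 τ).tendsto.eventually_eq_of_finite hS hxS
  have h3 := tendsto_leftLim_of_tendsto (hn.cadlag.2 τ)
  have h4 := (hn.cadlag.1 τ).tendsto
  rw [nhds_discrete, tendsto_pure] at h3 h4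
  rw [eventually_nhdsWithin_iff] at h1 h2 h3 h4
  refine ⟨Function.leftLim x τ, Function.leftLim n τ, ?_, ?_, ?_⟩
  · filter_upwards [h1, h2, h3, h4] with r a1 a2 a3 a4
    exact ⟨fun h => ⟨a1 h, a3 h⟩, fun h => ⟨a2 h, a4 h⟩⟩
  · unfold JumpsAt at hj
    tauto
  · by_cases h : Function.leftLim n τ = n τ
    · exact .inl h.symm
    · exact .inr (hn.unit_jumps τ h)

/-! ### Sums over uniform partitions -/

/-- The `k`-th point of the uniform partition of `[s, t]` into `m` intervals. -/
noncomputable def partitionPt (s t : ℝ≥0) (m k : ℕ) : ℝ≥0 := s + (k / m : ℝ≥0) * (t - s)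

theorem partitionPt_zero (s t : ℝ≥0) (m : ℕ) : partitionPt s t m 0 = s := by simp [partitionPt]

theorem partitionPt_self {s t : ℝ≥0} (hst : s ≤ t) {m : ℕ} (hm : m ≠ 0) :
    partitionPt s t m m = t := by
  have : (m : ℝ≥0) ≠ 0 := by exact_mod_cast hm
  simp [partitionPt, div_self this, add_tsub_cancel_of_le hst]

theorem partitionPt_mono (s t : ℝ≥0) (m : ℕ) : Monotone (partitionPt s t m) := by
  intro j k hjk
  unfold partitionPt
  gcongr

theorem le_partitionPt (s t : ℝ≥0) (m k : ℕ) : s ≤ partitionPt s t m k := le_self_add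

theorem coe_partitionPt_succ_sub {s t : ℝ≥0} (hst : s ≤ t) (m k : ℕ) :
    (partitionPt s t m (k + 1) : ℝ) - partitionPt s t m k = ((t : ℝ) - s) / m := by
  simp only [partitionPt, NNReal.coe_add, NNReal.coe_mul, NNReal.coe_div, NNReal.coe_sub hst,
    NNReal.coe_natCast]
  push_cast
  ring

/-- If a function of intervals vanishes on short intervals except those that contain one of the
locally finitely many exceptional times, where it is at most proportional to the length, then its
sums over uniform partitions tend to zero. -/
theorem tendsto_sum_partition_zero {e : ℝ≥0 → ℝ≥0 → ℝ} {C : ℝ} (hC : 0 ≤ C)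
    (he0 : ∀ a b, 0 ≤ e a b)
    (he : ∀ τ : ℝ≥0, ∃ ε > 0, ∀ a ∈ Metric.ball τ ε, ∀ b ∈ Metric.ball τ ε, a ≤ b →
      e a b = 0 ∨ (a < τ ∧ τ ≤ b ∧ e a b ≤ C * ((b : ℝ) - a)))
    {s t : ℝ≥0} (hst : s ≤ t) :
    Tendsto (fun m : ℕ => ∑ k ∈ Finset.range m,
      e (partitionPt s t m k) (partitionPt s t m (k + 1))) atTop (𝓝 0) := by
  choose ε hε he using he
  -- Finitely many balls cover `[s, t]`; once the mesh is below their Lebesgue number, each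
  -- partition interval lies in one ball and its term can be charged to the centre.
  obtain ⟨T, -, hT⟩ := (isCompact_Icc (a := s) (b := t)).elim_nhds_subcover
    (fun τ => Metric.ball τ (ε τ)) (fun τ _ => Metric.ball_mem_nhds τ (hε τ))
  obtain ⟨δ, hδ, hball⟩ := lebesgue_number_lemma_of_metric
    (c := fun τ : T => Metric.ball (τ : ℝ≥0) (ε τ)) (isCompact_Icc (a := s) (b := t))
    (fun _ => Metric.isOpen_ball) (fun r hr => by simpa using hT hr)
  have hlen : Tendsto (fun m : ℕ => ((t : ℝ) - s) / m) atTop (𝓝 0) :=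
    tendsto_const_div_atTop_nhds_zero_nat _
  have hlen0 (m : ℕ) : 0 ≤ ((t : ℝ) - s) / m :=
    div_nonneg (sub_nonneg.2 (NNReal.coe_le_coe.2 hst)) (Nat.cast_nonneg m)
  have hlim : Tendsto (fun m : ℕ => T.card * (C * (((t : ℝ) - s) / m))) atTop (𝓝 0) := by
    simpa using (hlen.const_mul C).const_mul (T.card : ℝ)
  refine squeeze_zero' (Eventually.of_forall fun m => Finset.sum_nonneg fun k _ => he0 _ _) ?_ hlim
  filter_upwards [hlen.eventually (gt_mem_nhds hδ)] with m hm
  have hterm (k : ℕ) (hk : k ∈ Finset.range m) :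
      e (partitionPt s t m k) (partitionPt s t m (k + 1)) ≤ ∑ τ ∈ T,
        if partitionPt s t m k < τ ∧ τ ≤ partitionPt s t m (k + 1) then
          C * (((t : ℝ) - s) / m) else 0 := by
    have hkm := Finset.mem_range.1 hk
    have hle := partitionPt_mono s t m (Nat.le_succ k)
    obtain ⟨⟨τ, hτT⟩, hτ⟩ := hball (partitionPt s t m k) ⟨le_partitionPt _ _ _ _,
      (partitionPt_mono s t m hkm.le).trans_eq (partitionPt_self hst (by lia))⟩
    have hb : partitionPt s t m (k + 1) ∈ Metric.ball (partitionPt s t m k) δ := by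
      rw [Metric.mem_ball, NNReal.dist_eq, coe_partitionPt_succ_sub hst, abs_of_nonneg (hlen0 m)]
      exact hm
    have hnn : ∀ σ ∈ T, (0 : ℝ) ≤ if partitionPt s t m k < σ ∧ σ ≤ partitionPt s t m (k + 1) then
          C * (((t : ℝ) - s) / m) else 0 := fun σ _ => by
      split_ifs
      · exact mul_nonneg hC (hlen0 m)
      · exact le_rfl
    rcases he τ _ (hτ (Metric.mem_ball_self hδ)) _ (hτ hb) hle with h | ⟨h1, h2, h3⟩
    · rw [h]
      exact Finset.sum_nonneg hnn
    · refine le_trans ?_ (Finset.single_le_sum hnn hτT)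
      rw [if_pos ⟨h1, h2⟩, ← coe_partitionPt_succ_sub hst m k]
      exact h3
  calc _ ≤ _ := Finset.sum_le_sum hterm
    _ = ∑ τ ∈ T, ∑ k ∈ Finset.range m,
        if partitionPt s t m k < τ ∧ τ ≤ partitionPt s t m (k + 1) then
          C * (((t : ℝ) - s) / m) else 0 := Finset.sum_comm
    _ ≤ ∑ τ ∈ T, C * (((t : ℝ) - s) / m) := by
        refine Finset.sum_le_sum fun τ _ => ?_
        rw [← Finset.sum_filter, Finset.sum_const, nsmul_eq_mul]
        refine mul_le_of_le_one_left (mul_nonneg hC (hlen0 m)) ?_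
        -- The half-open partition intervals are disjoint, so each centre is charged at most once.
        rw [Nat.cast_le_one, Finset.card_le_one]
        have key : ∀ j k, partitionPt s t m j < τ ∧ τ ≤ partitionPt s t m (j + 1) →
            partitionPt s t m k < τ ∧ τ ≤ partitionPt s t m (k + 1) → k ≤ j := by
          intro j k hj hk
          by_contra! hjk
          exact (hk.1.trans_le (hj.2.trans (partitionPt_mono s t m hjk))).false
        intro j hj k hk
        rw [Finset.mem_filter] at hj hk
        exact le_antisymm (key k j hk.2 hj.2) (key j k hj.2 hk.2)
    _ = T.card * (C * (((t : ℝ) - s) / m)) := by rw [Finset.sum_const, nsmul_eq_mul]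

/-! ### Pathwise first-order expansion -/

section Increments

variable {Ω : Type*} {d : ℕ} (u : ℝ) (Q : Matrix (Fin d) (Fin d) ℝ) (l : Fin d → ℝ)
  (X : ℝ≥0 → Ω → Fin d → ℝ) (N : ℝ≥0 → Ω → ℕ)

/-- Increment over `[a, b]` of the stochastic integral, frozen at time `a`, of the compensated
processes that drive `charVec`. -/
noncomputable def compensatedIncrement (a b : ℝ≥0) (ω : Ω) : Fin d → ℂ := fun j =>
  Complex.exp (Complex.I * u * N a ω) *
      ((X b ω j - X a ω j - (∫ r in (a : ℝ)..b, Q *ᵥ X r.toNNReal ω) j : ℝ) : ℂ) +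
    (Complex.exp (Complex.I * u) - 1) * charVec u X N a ω j *
      ((N b ω - N a ω - ∫ r in (a : ℝ)..b, l ⬝ᵥ X r.toNNReal ω : ℝ) : ℂ)

/-- Part of the first-order expansion of `charVec` that is due to multiple jumps. -/
noncomputable def jumpError (a b : ℝ≥0) (ω : Ω) : Fin d → ℂ := fun j =>
  (Complex.exp (Complex.I * u * N b ω) - Complex.exp (Complex.I * u * N a ω)) *
      ((X b ω j : ℂ) - X a ω j) +
    (Complex.exp (Complex.I * u * N b ω) - Complex.exp (Complex.I * u * N a ω) -
      (Complex.exp (Complex.I * u) - 1) * ((N b ω : ℂ) - N a ω) *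
        Complex.exp (Complex.I * u * N a ω)) * X a ω j

/-- Part of the first-order expansion of `charVec` that is due to freezing the chain in the
compensators. -/
noncomputable def driftError (a b : ℝ≥0) (ω : Ω) : Fin d → ℂ := fun j =>
  Complex.exp (Complex.I * u * N a ω) *
      (((∫ r in (a : ℝ)..b, Q *ᵥ X r.toNNReal ω) j - ((b : ℝ) - a) * (Q *ᵥ X a ω) j : ℝ) : ℂ) +
    (Complex.exp (Complex.I * u) - 1) * charVec u X N a ω j *
      ((∫ r in (a : ℝ)..b, l ⬝ᵥ X r.toNNReal ω) - ((b : ℝ) - a) * (l ⬝ᵥ X a ω) : ℝ)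

/-- On basis vectors the quadratic expression `X_j (l ⬝ᵥ X)` equals the linear one `l_j X_j`; this
is how `diag(l)` enters the generator. -/
theorem charGenerator_mulVec_charVec {a : ℝ≥0} {ω : Ω} (hX : ∃ i, X a ω = Pi.single i 1)
    (j : Fin d) :
    (charGenerator u Q l *ᵥ charVec u X N a ω) j =
      Complex.exp (Complex.I * u * N a ω) * ((Q *ᵥ X a ω) j : ℝ) +
        (Complex.exp (Complex.I * u) - 1) * charVec u X N a ω j * (l ⬝ᵥ X a ω : ℝ) := by
  have h1 : (X a ω j : ℂ) * (l ⬝ᵥ X a ω : ℝ) = l j * X a ω j := by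
    obtain ⟨i, hi⟩ := hX
    rw [hi]
    rcases eq_or_ne j i with rfl | hji
    · simp
    · simp [hji]
  rw [charGenerator, Matrix.add_mulVec, Matrix.smul_mulVec, Pi.add_apply, Pi.smul_apply,
    Matrix.mulVec_diagonal, smul_eq_mul, add_comm]
  congr 1
  · simp only [Matrix.mulVec, dotProduct, Matrix.map_apply, charVec]
    push_cast
    rw [Finset.mul_sum]
    exact Finset.sum_congr rfl fun i _ => by ring
  · simp only [charVec]
    linear_combination (-(Complex.exp (Complex.I * u) - 1) *
      Complex.exp (Complex.I * u * N a ω)) * h1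

theorem charVec_sub_eq {a b : ℝ≥0} {ω : Ω} (hX : ∃ i, X a ω = Pi.single i 1) :
    charVec u X N b ω - charVec u X N a ω =
      (((b : ℝ) - a : ℝ) : ℂ) • (charGenerator u Q l *ᵥ charVec u X N a ω) +
        compensatedIncrement u Q l X N a b ω +
        (jumpError u X N a b ω + driftError u Q l X N a b ω) := by
  ext j
  simp only [Pi.add_apply, Pi.sub_apply, Pi.smul_apply, smul_eq_mul,
    charGenerator_mulVec_charVec u Q l X N hX, compensatedIncrement, jumpError, driftError, charVec]
  push_cast
  ring

theorem norm_exp_I_mul_natCast (n : ℕ) : ‖Complex.exp (Complex.I * u * n)‖ = 1 := by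
  have : Complex.I * u * n = ((u * n : ℝ) : ℂ) * Complex.I := by push_cast; ring
  rw [this, Complex.norm_exp_ofReal_mul_I]

theorem norm_exp_I_sub_one_le : ‖Complex.exp (Complex.I * u) - 1‖ ≤ 2 := by
  have h := norm_exp_I_mul_natCast u 1
  rw [Nat.cast_one, mul_one] at h
  calc _ ≤ ‖Complex.exp (Complex.I * u)‖ + ‖(1 : ℂ)‖ := norm_sub_le _ _
    _ = 2 := by rw [h, norm_one]; norm_num

theorem abs_le_one_of_eq_single {x : Fin d → ℝ} (hx : ∃ i, x = Pi.single i 1) (j : Fin d) :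
    |x j| ≤ 1 := by
  obtain ⟨i, rfl⟩ := hx
  rcases eq_or_ne j i with rfl | hji
  · simp
  · simp [hji]

theorem norm_charVec_apply_le {a : ℝ≥0} {ω : Ω} (hX : ∃ i, X a ω = Pi.single i 1) (j : Fin d) :
    ‖charVec u X N a ω j‖ ≤ 1 := by
  rw [charVec, norm_mul, norm_exp_I_mul_natCast, one_mul, Complex.norm_real, Real.norm_eq_abs]
  exact abs_le_one_of_eq_single hX j

/-- If `N` is unchanged, both terms vanish. If it rises by one, `X` is unchanged, which kills the
product term, and `e^{iu(n+1)} - e^{iun} = (e^{iu} - 1) e^{iun}` kills the other. -/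
theorem jumpError_eq_zero {a b : ℝ≥0} {ω : Ω} (h : X a ω = X b ω ∨ N a ω = N b ω)
    (hN : N b ω = N a ω ∨ N b ω = N a ω + 1) : jumpError u X N a b ω = 0 := by
  ext j
  rw [jumpError]
  rcases hN with hN | hN
  · simp [hN]
  · have hX : X a ω = X b ω := h.resolve_right (by lia)
    rw [hN, hX]
    have : Complex.exp (Complex.I * u * (N a ω + 1 : ℕ)) =
        Complex.exp (Complex.I * u * N a ω) * Complex.exp (Complex.I * u) := by
      rw [← Complex.exp_add]
      push_cast
      ring_nf
    rw [this]
    push_cast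
    simp only [Pi.zero_apply]
    ring

/-- The bound is proportional to the increment of `N` so that it telescopes over a partition. A
nonzero increment `δ` is at least one, whence `4 + (2 + 2δ) ≤ 8δ`. -/
theorem norm_jumpError_le {a b : ℝ≥0} {ω : Ω} (hXa : ∃ i, X a ω = Pi.single i 1)
    (hXb : ∃ i, X b ω = Pi.single i 1) (hN : N a ω ≤ N b ω) :
    ‖jumpError u X N a b ω‖ ≤ 8 * ((N b ω : ℝ) - N a ω) := by
  rcases hN.eq_or_lt with h | h
  · rw [jumpError_eq_zero u X N (.inr h) (.inl h.symm), h]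
    simp
  have h1 : (1 : ℝ) ≤ (N b ω : ℝ) - N a ω := by
    have : ((N a ω + 1 : ℕ) : ℝ) ≤ N b ω := by exact_mod_cast h
    push_cast at this
    linarith
  rw [pi_norm_le_iff_of_nonneg (by linarith)]
  intro j
  have hx1 : ‖(X a ω j : ℂ)‖ ≤ 1 := by
    rw [Complex.norm_real]; exact abs_le_one_of_eq_single hXa j
  have hx2 : ‖(X b ω j : ℂ)‖ ≤ 1 := by
    rw [Complex.norm_real]; exact abs_le_one_of_eq_single hXb j
  have he1 := norm_exp_I_mul_natCast u (N a ω)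
  have he2 := norm_exp_I_mul_natCast u (N b ω)
  have he := norm_exp_I_sub_one_le u
  have hn : ‖(N b ω : ℂ) - N a ω‖ = (N b ω : ℝ) - N a ω := by
    rw [show (N b ω : ℂ) - N a ω = (((N b ω : ℝ) - N a ω : ℝ) : ℂ) by push_cast; rfl,
      Complex.norm_real, Real.norm_of_nonneg (by linarith)]
  set δ := (N b ω : ℝ) - N a ω
  have hd : ‖Complex.exp (Complex.I * u * N b ω) - Complex.exp (Complex.I * u * N a ω)‖ ≤ 2 :=
    (norm_sub_le _ _).trans (by linarith)
  have hT1 : ‖(Complex.exp (Complex.I * u * N b ω) - Complex.exp (Complex.I * u * N a ω)) *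
      ((X b ω j : ℂ) - X a ω j)‖ ≤ 2 * 2 := by
    rw [norm_mul]
    have := norm_sub_le (X b ω j : ℂ) (X a ω j : ℂ)
    gcongr
    linarith
  have hT2 : ‖(Complex.exp (Complex.I * u * N b ω) - Complex.exp (Complex.I * u * N a ω) -
      (Complex.exp (Complex.I * u) - 1) * ((N b ω : ℂ) - N a ω) *
        Complex.exp (Complex.I * u * N a ω)) * X a ω j‖ ≤ (2 + 2 * δ * 1) * 1 := by
    rw [norm_mul]
    gcongr
    refine (norm_sub_le _ _).trans ?_
    gcongr
    rw [norm_mul, norm_mul, hn, he1]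
    gcongr
  refine (norm_add_le _ _).trans ?_
  linarith

/-- A bound for the entries of `Q *ᵥ x` and for `l ⬝ᵥ x` when the entries of `x` are at most one
in absolute value. -/
noncomputable def rateBound : ℝ := ∑ i, ∑ j, |Q i j| + ∑ j, |l j|

theorem rateBound_nonneg : 0 ≤ rateBound Q l := by unfold rateBound; positivity

theorem abs_dotProduct_le {x : Fin d → ℝ} (hx : ∀ j, |x j| ≤ 1) (v : Fin d → ℝ) :
    |v ⬝ᵥ x| ≤ ∑ j, |v j| := by
  refine (Finset.abs_sum_le_sum_abs _ _).trans (Finset.sum_le_sum fun j _ => ?_)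
  rw [abs_mul]
  exact mul_le_of_le_one_right (abs_nonneg _) (hx j)

theorem norm_mulVec_le_rateBound {x : Fin d → ℝ} (hx : ∀ j, |x j| ≤ 1) :
    ‖Q *ᵥ x‖ ≤ rateBound Q l := by
  rw [pi_norm_le_iff_of_nonneg (rateBound_nonneg Q l)]
  intro i
  have h1 : ∑ j, |Q i j| ≤ ∑ i, ∑ j, |Q i j| :=
    Finset.single_le_sum (f := fun i => ∑ j, |Q i j|)
      (fun i _ => Finset.sum_nonneg fun j _ => abs_nonneg _) (Finset.mem_univ i)
  have h2 : 0 ≤ ∑ j, |l j| := Finset.sum_nonneg fun j _ => abs_nonneg _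
  have h3 := abs_dotProduct_le hx (Q i)
  rw [Real.norm_eq_abs, rateBound]
  exact h3.trans (by linarith)

theorem abs_dotProduct_le_rateBound {x : Fin d → ℝ} (hx : ∀ j, |x j| ≤ 1) :
    |l ⬝ᵥ x| ≤ rateBound Q l := by
  have h2 : 0 ≤ ∑ i, ∑ j, |Q i j| :=
    Finset.sum_nonneg fun i _ => Finset.sum_nonneg fun j _ => abs_nonneg _
  rw [rateBound]
  exact (abs_dotProduct_le hx l).trans (by linarith)

theorem norm_driftError_le {a b : ℝ≥0} {ω : Ω} (hX : ∀ t, ∃ i, X t ω = Pi.single i 1)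
    (hab : a ≤ b) :
    ‖driftError u Q l X N a b ω‖ ≤ 6 * rateBound Q l * ((b : ℝ) - a) := by
  have hX1 := fun t => abs_le_one_of_eq_single (hX t)
  have hab' : (0 : ℝ) ≤ b - a := sub_nonneg.2 (NNReal.coe_le_coe.2 hab)
  have hK := rateBound_nonneg Q l
  set K := rateBound Q l with hKdef
  have hI1 : ‖∫ r in (a : ℝ)..b, Q *ᵥ X r.toNNReal ω‖ ≤ K * (b - a) := by
    rw [← abs_of_nonneg hab']
    exact intervalIntegral.norm_integral_le_of_norm_le_const fun r _ =>
      norm_mulVec_le_rateBound Q l (hX1 _)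
  have hI2 : ‖∫ r in (a : ℝ)..b, l ⬝ᵥ X r.toNNReal ω‖ ≤ K * (b - a) := by
    rw [← abs_of_nonneg hab']
    exact intervalIntegral.norm_integral_le_of_norm_le_const fun r _ =>
      abs_dotProduct_le_rateBound Q l (hX1 _)
  rw [pi_norm_le_iff_of_nonneg (by positivity)]
  intro j
  have hT3 : ‖Complex.exp (Complex.I * u * N a ω) * (((∫ r in (a : ℝ)..b, Q *ᵥ X r.toNNReal ω) j -
      ((b : ℝ) - a) * (Q *ᵥ X a ω) j : ℝ) : ℂ)‖ ≤ 2 * K * (b - a) := by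
    rw [norm_mul, norm_exp_I_mul_natCast, one_mul, Complex.norm_real]
    refine (norm_sub_le _ _).trans ?_
    rw [norm_mul, Real.norm_of_nonneg hab']
    have h1 := (norm_le_pi_norm _ j).trans hI1
    have h2 : (b - a : ℝ) * ‖(Q *ᵥ X a ω) j‖ ≤ (b - a) * K := by
      gcongr
      exact (norm_le_pi_norm _ j).trans (norm_mulVec_le_rateBound Q l (hX1 _))
    linarith
  have hT4 : ‖(Complex.exp (Complex.I * u) - 1) * charVec u X N a ω j *
      (((∫ r in (a : ℝ)..b, l ⬝ᵥ X r.toNNReal ω) - ((b : ℝ) - a) * (l ⬝ᵥ X a ω) : ℝ) : ℂ)‖ ≤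
      2 * 1 * (2 * K * (b - a)) := by
    rw [norm_mul, norm_mul, Complex.norm_real]
    have he := norm_exp_I_sub_one_le u
    have hz := norm_charVec_apply_le u X N (hX a) j
    gcongr
    refine (norm_sub_le _ _).trans ?_
    rw [norm_mul, Real.norm_of_nonneg hab']
    have h2 : (b - a : ℝ) * ‖l ⬝ᵥ X a ω‖ ≤ (b - a) * K := by
      gcongr
      exact abs_dotProduct_le_rateBound Q l (hX1 _)
    linarith
  refine (norm_add_le _ _).trans ?_
  linarith

theorem driftError_eq_zero {a b : ℝ≥0} {ω : Ω} (hab : a ≤ b)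
    (hX : ∀ r, a ≤ r → r ≤ b → X r ω = X a ω) : driftError u Q l X N a b ω = 0 := by
  have hXr : ∀ r ∈ Set.uIcc (a : ℝ) b, X r.toNNReal ω = X a ω := by
    intro r hr
    rw [Set.uIcc_of_le (NNReal.coe_le_coe.2 hab)] at hr
    refine hX _ ?_ ?_
    · rw [← NNReal.coe_le_coe, Real.coe_toNNReal _ (a.2.trans hr.1)]
      exact hr.1
    · rw [← NNReal.coe_le_coe, Real.coe_toNNReal _ (a.2.trans hr.1)]
      exact hr.2
  have h1 : ∫ r in (a : ℝ)..b, Q *ᵥ X r.toNNReal ω = ((b : ℝ) - a) • (Q *ᵥ X a ω) := by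
    rw [← intervalIntegral.integral_const]
    exact intervalIntegral.integral_congr fun r hr => by rw [hXr r hr]
  have h2 : ∫ r in (a : ℝ)..b, l ⬝ᵥ X r.toNNReal ω = ((b : ℝ) - a) • (l ⬝ᵥ X a ω) := by
    rw [← intervalIntegral.integral_const]
    exact intervalIntegral.integral_congr fun r hr => by rw [hXr r hr]
  ext j
  rw [driftError, h1, h2]
  simp

/-- The remainder in the first-order expansion of `charVec`. -/
noncomputable def expansionError (a b : ℝ≥0) (ω : Ω) : Fin d → ℂ :=
  jumpError u X N a b ω + driftError u Q l X N a b ω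

theorem norm_expansionError_le {a b : ℝ≥0} {ω : Ω} (hX : ∀ t, ∃ i, X t ω = Pi.single i 1)
    (hN : Monotone fun t => N t ω) (hab : a ≤ b) :
    ‖expansionError u Q l X N a b ω‖ ≤
      8 * ((N b ω : ℝ) - N a ω) + 6 * rateBound Q l * ((b : ℝ) - a) :=
  (norm_add_le _ _).trans (add_le_add (norm_jumpError_le u X N (hX a) (hX b) (hN hab))
    (norm_driftError_le u Q l X N hX hab))

/-- Near `τ` both paths are constant before `τ` and from `τ` on, so only an interval with `a < τ ≤
b` has an error, and there the jump part is zero and the drift part is `O(b - a)`. -/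
theorem tendsto_sum_expansionError {ω : Ω} (hX : ∀ t, ∃ i, X t ω = Pi.single i 1)
    (hXc : IsCadlagPath fun t => X t ω) (hN : IsCountingPath fun t => N t ω)
    (hj : ∀ t, ¬ (JumpsAt (fun r => X r ω) t ∧ JumpsAt (fun r => N r ω) t))
    {s t : ℝ≥0} (hst : s ≤ t) :
    Tendsto (fun m : ℕ => ∑ k ∈ Finset.range m,
      ‖expansionError u Q l X N (partitionPt s t m k) (partitionPt s t m (k + 1)) ω‖)
      atTop (𝓝 0) := by
  refine tendsto_sum_partition_zero (e := fun a b => ‖expansionError u Q l X N a b ω‖)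
    (C := 6 * rateBound Q l) (mul_nonneg (by norm_num) (rateBound_nonneg Q l))
    (fun a b => norm_nonneg _) (fun τ => ?_) hst
  obtain ⟨x₀, n₀, hloc, hone, hunit⟩ := eventually_constant_pair hX hXc hN (hj τ)
  obtain ⟨ε, hε, hball⟩ := Metric.eventually_nhds_iff_ball.1 hloc
  refine ⟨ε, hε, fun a ha b hb hab => ?_⟩
  have hconst : (∀ r, a ≤ r → r ≤ b → X r ω = X a ω ∧ N r ω = N a ω) →
      ‖expansionError u Q l X N a b ω‖ = 0 := fun h => by
    have hb' := h b hab le_rfl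
    rw [expansionError, driftError_eq_zero u Q l X N hab fun r h1 h2 => (h r h1 h2).1,
      jumpError_eq_zero u X N (.inl hb'.1.symm) (.inl hb'.2), add_zero, norm_zero]
  have hmem : ∀ r, a ≤ r → r ≤ b → r ∈ Metric.ball τ ε := by
    intro r h1 h2
    rw [Metric.mem_ball, NNReal.dist_eq, abs_lt] at ha hb ⊢
    rw [← NNReal.coe_le_coe] at h1 h2
    constructor <;> linarith [ha.1, hb.2]
  rcases lt_or_ge b τ with hbτ | hbτ
  · refine .inl (hconst fun r h1 h2 => ?_)
    have e1 := (hball r (hmem r h1 h2)).1 (h2.trans_lt hbτ)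
    have e2 := (hball a ha).1 (hab.trans_lt hbτ)
    exact ⟨e1.1.trans e2.1.symm, e1.2.trans e2.2.symm⟩
  rcases lt_or_ge a τ with haτ | haτ
  · refine .inr ⟨haτ, hbτ, ?_⟩
    have e1 := (hball a ha).1 haτ
    have e2 := (hball b hb).2 hbτ
    rw [expansionError, jumpError_eq_zero u X N (by rw [e1.1, e1.2, e2.1, e2.2]; exact hone)
      (by rw [e1.2, e2.2]; exact hunit), zero_add]
    exact norm_driftError_le u Q l X N hX hab
  · refine .inl (hconst fun r h1 h2 => ?_)
    have e1 := (hball r (hmem r h1 h2)).2 (haτ.trans h1)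
    have e2 := (hball a ha).2 haτ
    exact ⟨e1.1.trans e2.1.symm, e1.2.trans e2.2.symm⟩

end Increments

/-! ### Matrix exponential and the approximate linear equation -/

section Exponential

attribute [local instance] Matrix.linftyOpNormedRing Matrix.linftyOpNormedAlgebra

/-- Since `exp(zG)` has derivative `G` at `z = 0`, the remainder is `o(1/m)`. -/
theorem tendsto_natCast_mul_exp_remainder {d : ℕ} (G : Matrix (Fin d) (Fin d) ℂ) (T : ℝ) :
    Tendsto (fun m : ℕ => (m : ℝ) *
      ‖NormedSpace.exp (((T / m : ℝ) : ℂ) • G) - 1 - ((T / m : ℝ) : ℂ) • G‖) atTop (𝓝 0) := by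
  have hder := (hasDerivAt_exp_smul_const (𝕂 := ℂ) G (0 : ℂ)).isLittleO
  have hlim : Tendsto (fun m : ℕ => ((T / m : ℝ) : ℂ)) atTop (𝓝 0) := by
    have := Complex.continuous_ofReal.continuousAt.tendsto.comp
      (tendsto_const_div_atTop_nhds_zero_nat T)
    rwa [Complex.ofReal_zero] at this
  have ho := (hder.comp_tendsto hlim).norm_left
  have ho2 := (Asymptotics.isBigO_refl (fun m : ℕ => (m : ℝ)) atTop).mul_isLittleO ho.norm_right
  have hO : (fun m : ℕ => (m : ℝ) * ‖((T / m : ℝ) : ℂ)‖) =O[atTop] (fun _ => (1 : ℝ)) := by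
    refine Asymptotics.IsBigO.of_bound |T| (Eventually.of_forall fun m => ?_)
    rcases eq_or_ne m 0 with rfl | hm
    · simp
    · have : (m : ℝ) ≠ 0 := by exact_mod_cast hm
      rw [Complex.norm_real, norm_div, Real.norm_natCast, mul_div_cancel₀ _ this]
      simp
  have hfin := Asymptotics.isLittleO_one_iff ℝ |>.1 (ho2.trans_isBigO (by
    simpa [Function.comp_def] using hO))
  simp only [Function.comp_def, zero_smul, NormedSpace.exp_zero, sub_zero, one_mul] at hfin
  exact hfin

/-- A bounded function that satisfies `g' = G g` up to errors whose sums over uniform partitions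
tend to zero is given by the matrix exponential. -/
theorem eq_exp_smul_mulVec_of_tendsto_sum {d : ℕ} {G : Matrix (Fin d) (Fin d) ℂ}
    {g : ℝ≥0 → Fin d → ℂ} {η : ℝ≥0 → ℝ≥0 → ℝ} {s t : ℝ≥0} (hst : s ≤ t) (hg : ∀ r, ‖g r‖ ≤ 1)
    (h : ∀ a b, s ≤ a → a ≤ b →
      ‖g b - g a - (((b : ℝ) - a : ℝ) : ℂ) • (G *ᵥ g a)‖ ≤ η a b)
    (hη : Tendsto (fun m : ℕ => ∑ k ∈ Finset.range m,
      η (partitionPt s t m k) (partitionPt s t m (k + 1))) atTop (𝓝 0)) :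
    g t = NormedSpace.exp ((((t : ℝ) - s : ℝ) : ℂ) • G) *ᵥ g s := by
  obtain ⟨C, hC⟩ : ∃ C, ∀ r ∈ Set.Icc (0 : ℝ) t,
      ‖NormedSpace.exp ((((t : ℝ) - r : ℝ) : ℂ) • G)‖ ≤ C := by
    refine isCompact_Icc.exists_bound_of_continuousOn (Continuous.continuousOn ?_)
    exact NormedSpace.exp_continuous.comp (by fun_prop)
  have hC0 : 0 ≤ C := (norm_nonneg _).trans (hC 0 ⟨le_rfl, t.2⟩)
  let δ : ℕ → ℝ := fun m => ((t : ℝ) - s) / m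
  let R : ℕ → ℝ := fun m => ‖NormedSpace.exp ((δ m : ℂ) • G) - 1 - (δ m : ℂ) • G‖
  have hbound (m : ℕ) (hm : m ≠ 0) :
      ‖g t - NormedSpace.exp ((((t : ℝ) - s : ℝ) : ℂ) • G) *ᵥ g s‖ ≤
        C * (∑ k ∈ Finset.range m, η (partitionPt s t m k) (partitionPt s t m (k + 1)) +
          m * R m) := by
    -- Propagating each `g (t_k)` to the final time gives a sequence from `exp((t - s)G) g s` to `g
    -- t` whose steps are local errors only.
    let f : ℕ → Fin d → ℂ := fun k =>
      NormedSpace.exp ((((t : ℝ) - partitionPt s t m k : ℝ) : ℂ) • G) *ᵥ g (partitionPt s t m k)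
    have hf0 : f 0 = NormedSpace.exp ((((t : ℝ) - s : ℝ) : ℂ) • G) *ᵥ g s := by
      simp only [f, partitionPt_zero]
    have hfm : f m = g t := by
      simp only [f, partitionPt_self hst hm, sub_self, Complex.ofReal_zero, zero_smul,
        NormedSpace.exp_zero, Matrix.one_mulVec]
    rw [← hf0, ← hfm, ← Finset.sum_range_sub, ← nsmul_eq_mul, ← Finset.card_range m,
      ← Finset.sum_const, Finset.card_range, ← Finset.sum_add_distrib, Finset.mul_sum]
    refine norm_sum_le_of_le _ fun k hk => ?_
    have hkm := Finset.mem_range.1 hk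
    set a := partitionPt s t m k
    set b := partitionPt s t m (k + 1)
    have hδ : (b : ℝ) - a = δ m := coe_partitionPt_succ_sub hst m k
    have hbt : b ≤ t := (partitionPt_mono s t m hkm).trans_eq (partitionPt_self hst hm)
    have hstep : f (k + 1) - f k = NormedSpace.exp ((((t : ℝ) - b : ℝ) : ℂ) • G) *ᵥ
        ((g b - g a - (((b : ℝ) - a : ℝ) : ℂ) • (G *ᵥ g a)) -
          (NormedSpace.exp ((δ m : ℂ) • G) - 1 - (δ m : ℂ) • G) *ᵥ g a) := by
      have hadd : (((t : ℝ) - a : ℝ) : ℂ) • G =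
          (((t : ℝ) - b : ℝ) : ℂ) • G + (δ m : ℂ) • G := by
        rw [← add_smul, ← Complex.ofReal_add, ← hδ]
        congr 2
        ring
      have hexp : NormedSpace.exp ((((t : ℝ) - a : ℝ) : ℂ) • G) =
          NormedSpace.exp ((((t : ℝ) - b : ℝ) : ℂ) • G) * NormedSpace.exp ((δ m : ℂ) • G) := by
        rw [hadd]
        exact Matrix.exp_add_of_commute _ _
          (((Commute.refl G).smul_left _).smul_right _)
      simp only [f]
      rw [hexp, ← Matrix.mulVec_mulVec, ← Matrix.mulVec_sub, hδ]
      congr 1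
      rw [Matrix.sub_mulVec, Matrix.sub_mulVec, Matrix.one_mulVec, Matrix.smul_mulVec]
      abel
    rw [hstep]
    refine (Matrix.linfty_opNorm_mulVec _ _).trans ?_
    gcongr
    · exact hC _ ⟨b.2, NNReal.coe_le_coe.2 hbt⟩
    · refine (norm_sub_le _ _).trans (add_le_add (h a b (le_partitionPt _ _ _ _)
        (partitionPt_mono s t m (Nat.le_succ k))) ?_)
      refine (Matrix.linfty_opNorm_mulVec _ _).trans ?_
      exact mul_le_of_le_one_right (norm_nonneg _) (hg _)
  have hlim := (hη.add (tendsto_natCast_mul_exp_remainder G ((t : ℝ) - s))).const_mul C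
  rw [add_zero, mul_zero] at hlim
  have hle := ge_of_tendsto hlim ((eventually_ne_atTop 0).mono hbound)
  exact sub_eq_zero.1 (norm_le_zero_iff.1 hle)

end Exponential

/-! ### Martingale increments against bounded past factors -/

section Martingale

variable {Ω : Type*} {mΩ : MeasurableSpace Ω} {μ : Measure Ω} {𝓕 : Filtration ℝ≥0 mΩ}

theorem MeasureTheory.Martingale.eval {ι : Type*} [Fintype ι] {M : ℝ≥0 → Ω → ι → ℝ}
    (hM : Martingale M 𝓕 μ) (j : ι) : Martingale (fun t ω => M t ω j) 𝓕 μ := by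
  let p : (ι → ℝ) →L[ℝ] ℝ := ContinuousLinearMap.proj j
  refine ⟨fun t => p.continuous.comp_stronglyMeasurable (hM.stronglyMeasurable t),
    fun a b hab => ?_⟩
  refine (p.comp_condExp_comm (hM.integrable b)).symm.trans ?_
  filter_upwards [hM.condExp_ae_eq hab] with ω hω
  simp [p, hω]

theorem MeasureTheory.Martingale.integrable_mul_increment [IsFiniteMeasure μ] {M : ℝ≥0 → Ω → ℝ}
    (hM : Martingale M 𝓕 μ) (a b : ℝ≥0) {ψ : Ω → ℂ} {c : ℝ} (hψ : StronglyMeasurable[𝓕 a] ψ)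
    (hc : ∀ ω, ‖ψ ω‖ ≤ c) : Integrable (fun ω => ψ ω * ((M b ω - M a ω : ℝ) : ℂ)) μ :=
  ((hM.integrable b).sub (hM.integrable a)).ofReal.bdd_mul
    (hψ.mono (𝓕.le a)).aestronglyMeasurable (Eventually.of_forall hc)

theorem MeasureTheory.Martingale.setIntegral_mul_increment [IsFiniteMeasure μ] {M : ℝ≥0 → Ω → ℝ}
    (hM : Martingale M 𝓕 μ) {a b : ℝ≥0} (hab : a ≤ b) {ψ : Ω → ℂ} {c : ℝ}
    (hψ : StronglyMeasurable[𝓕 a] ψ) (hc : ∀ ω, ‖ψ ω‖ ≤ c) {A : Set Ω}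
    (hA : MeasurableSet[𝓕 a] A) : ∫ ω in A, ψ ω * ((M b ω - M a ω : ℝ) : ℂ) ∂μ = 0 := by
  have hint := (hM.integrable b).sub (hM.integrable a)
  have hinc : μ[M b - M a | 𝓕 a] =ᵐ[μ] 0 := by
    filter_upwards [condExp_sub (hM.integrable b) (hM.integrable a) (𝓕 a),
      hM.condExp_ae_eq hab, hM.condExp_ae_eq (le_refl a)] with ω h1 h2 h3
    rw [h1, Pi.sub_apply, h2, h3, sub_self, Pi.zero_apply]
  -- The increment is real and the factor complex, so the pull-out uses real scalar multiplication
  -- on `ℂ` as the bilinear map.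
  have hpull := condExp_stronglyMeasurable_bilin_of_bound
    ((ContinuousLinearMap.lsmul ℝ ℝ (E := ℂ)).flip) (𝓕.le a) hψ hint c (Eventually.of_forall hc)
  have heq : (fun ω => (ContinuousLinearMap.lsmul ℝ ℝ (E := ℂ)).flip (ψ ω) ((M b - M a) ω)) =
      fun ω => ψ ω * ((M b ω - M a ω : ℝ) : ℂ) := by
    ext ω
    simp [mul_comm]
  rw [heq] at hpull
  rw [← setIntegral_condExp (𝓕.le a) (hM.integrable_mul_increment a b hψ hc) hA]
  refine integral_eq_zero_of_ae (ae_restrict_of_ae ?_)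
  filter_upwards [hpull, hinc] with ω h1 h2
  rw [h1, h2]
  simp

end Martingale

/-! ### Time integrals along the chain -/

section Paths

variable {d : ℕ} {x : ℝ≥0 → Fin d → ℝ}

theorem intervalIntegrable_comp_toNNReal {E : Type*} [NormedAddCommGroup E]
    (hx : ∀ t, ∃ i, x t = Pi.single i 1) (hxc : IsCadlagPath x) {φ : (Fin d → ℝ) → E}
    (hφ : Continuous φ) (a b : ℝ) :
    IntervalIntegrable (fun r : ℝ => φ (x r.toNNReal)) volume a b := by
  have hmeas : StronglyMeasurable fun r : ℝ => φ (x r.toNNReal) :=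
    hφ.comp_stronglyMeasurable
      ((measurable_of_continuousWithinAt_Ici hxc.1).comp measurable_real_toNNReal).stronglyMeasurable
  obtain ⟨C, hC⟩ := ((Set.finite_range fun i : Fin d => φ (Pi.single i 1)).isCompact).isBounded
    |>.exists_norm_le
  refine (intervalIntegrable_const (c := C)).mono_fun hmeas.aestronglyMeasurable
    (Eventually.of_forall fun r => ?_)
  obtain ⟨i, hi⟩ := hx r.toNNReal
  simp only [hi]
  exact (hC _ ⟨i, rfl⟩).trans (Real.le_norm_self C)

theorem integral_sub_integral_comp_toNNReal {E : Type*} [NormedAddCommGroup E] [NormedSpace ℝ E]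
    (hx : ∀ t, ∃ i, x t = Pi.single i 1) (hxc : IsCadlagPath x) {φ : (Fin d → ℝ) → E}
    (hφ : Continuous φ) (a b : ℝ) :
    ∫ r in a..b, φ (x r.toNNReal) =
      (∫ r in (0 : ℝ)..b, φ (x r.toNNReal)) - ∫ r in (0 : ℝ)..a, φ (x r.toNNReal) :=
  (intervalIntegral.integral_interval_sub_left (intervalIntegrable_comp_toNNReal hx hxc hφ 0 b)
    (intervalIntegrable_comp_toNNReal hx hxc hφ 0 a)).symm

end Paths

theorem MeasureTheory.Integrable.mulVec {Ω : Type*} {mΩ : MeasurableSpace Ω} {μ : Measure Ω} {d : ℕ}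
    {f : Ω → Fin d → ℂ} (hf : Integrable f μ) (B : Matrix (Fin d) (Fin d) ℂ) :
    Integrable (fun ω => B *ᵥ f ω) μ :=
  (LinearMap.toContinuousLinearMap B.mulVecLin).integrable_comp hf

theorem setIntegral_mulVec {Ω : Type*} {mΩ : MeasurableSpace Ω} {μ : Measure Ω} {d : ℕ}
    {f : Ω → Fin d → ℂ} (hf : Integrable f μ) (B : Matrix (Fin d) (Fin d) ℂ) (A : Set Ω) :
    ∫ ω in A, B *ᵥ f ω ∂μ = B *ᵥ ∫ ω in A, f ω ∂μ :=
  (LinearMap.toContinuousLinearMap B.mulVecLin).integral_comp_comm hf.integrableOn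

/-! ### From the expansion to integrals over past events -/

namespace IsMMPoissonProcess

variable {Ω : Type*} {mΩ : MeasurableSpace Ω} {μ : Measure Ω}
  {𝓕 : Filtration ℝ≥0 mΩ} {d : ℕ} {Q : Matrix (Fin d) (Fin d) ℝ} {l : Fin d → ℝ}
  {X : ℝ≥0 → Ω → Fin d → ℝ} {N : ℝ≥0 → Ω → ℕ}

theorem stronglyMeasurable_exp (h : IsMMPoissonProcess μ 𝓕 Q l X N) (u : ℝ) (a : ℝ≥0) :
    StronglyMeasurable[𝓕 a] fun ω => Complex.exp (Complex.I * u * N a ω) :=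
  ((measurable_from_nat (f := fun n : ℕ => Complex.exp (Complex.I * u * n))).comp
    (h.adapted a)).stronglyMeasurable

theorem stronglyMeasurable_charVec_apply (h : IsMMPoissonProcess μ 𝓕 Q l X N) (u : ℝ) (a : ℝ≥0)
    (j : Fin d) : StronglyMeasurable[𝓕 a] fun ω => charVec u X N a ω j := by
  have hX : Measurable[𝓕 a] fun ω => X a ω j :=
    (measurable_pi_apply j).comp (h.chain.adapted a)
  exact (h.stronglyMeasurable_exp u a).mul
    (Complex.measurable_ofReal.comp hX).stronglyMeasurable

theorem stronglyMeasurable_charVec (h : IsMMPoissonProcess μ 𝓕 Q l X N) (u : ℝ) (a : ℝ≥0) :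
    StronglyMeasurable[𝓕 a] (charVec u X N a) := by
  have : Measurable[𝓕 a] (charVec u X N a) :=
    @measurable_pi_lambda _ _ _ (𝓕 a) _ _ fun j =>
      (h.stronglyMeasurable_charVec_apply u a j).measurable
  exact this.stronglyMeasurable

theorem norm_charVec_le (h : IsMMPoissonProcess μ 𝓕 Q l X N) (u : ℝ) (a : ℝ≥0) (ω : Ω) :
    ‖charVec u X N a ω‖ ≤ 1 :=
  (pi_norm_le_iff_of_nonneg zero_le_one).2
    (norm_charVec_apply_le u X N (h.chain.basis_valued a ω))

theorem integrable_charVec [IsProbabilityMeasure μ] (h : IsMMPoissonProcess μ 𝓕 Q l X N) (u : ℝ) (a : ℝ≥0) :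
    Integrable (charVec u X N a) μ :=
  .of_bound ((h.stronglyMeasurable_charVec u a).mono (𝓕.le a)).aestronglyMeasurable 1
    (Eventually.of_forall (h.norm_charVec_le u a))

theorem integrable_counting [IsProbabilityMeasure μ] (h : IsMMPoissonProcess μ 𝓕 Q l X N) (a : ℝ≥0) :
    Integrable (fun ω => (N a ω : ℝ)) μ := by
  have hN : Measurable fun ω => (N a ω : ℝ) :=
    measurable_from_nat.comp ((h.adapted a).mono (𝓕.le a) le_rfl)
  have hm := h.martingale.integrable a
  have hI : Integrable (fun ω => ∫ r in (0 : ℝ)..a, l ⬝ᵥ X r.toNNReal ω) μ := by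
    refine .of_bound (C := rateBound Q l * |(a : ℝ) - 0|) ?_ (Eventually.of_forall fun ω =>
      intervalIntegral.norm_integral_le_of_norm_le_const fun r _ =>
        abs_dotProduct_le_rateBound Q l (abs_le_one_of_eq_single (h.chain.basis_valued _ ω)))
    -- The compensator is `N` minus the martingale, so its measurability in `ω` needs no joint
    -- measurability of `X`.
    exact (hN.aestronglyMeasurable.sub hm.aestronglyMeasurable).congr
      (Eventually.of_forall fun ω => sub_sub_cancel _ _)
  exact (hm.add hI).congr (Eventually.of_forall fun ω => sub_add_cancel _ _)

/-- Exhibits genuine martingale increments, by splitting the integral over `[a, b]` at time `0`. -/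
theorem compensatedIncrement_eq (h : IsMMPoissonProcess μ 𝓕 Q l X N) (u : ℝ) (a b : ℝ≥0)
    (j : Fin d) :
    (fun ω => compensatedIncrement u Q l X N a b ω j) = fun ω =>
      Complex.exp (Complex.I * u * N a ω) *
        (((X b ω - ∫ r in (0 : ℝ)..b, Q *ᵥ X r.toNNReal ω) j -
          (X a ω - ∫ r in (0 : ℝ)..a, Q *ᵥ X r.toNNReal ω) j : ℝ) : ℂ) +
      (Complex.exp (Complex.I * u) - 1) * charVec u X N a ω j *
        (((N b ω - ∫ r in (0 : ℝ)..b, l ⬝ᵥ X r.toNNReal ω) -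
          (N a ω - ∫ r in (0 : ℝ)..a, l ⬝ᵥ X r.toNNReal ω) : ℝ) : ℂ) := by
  ext ω
  have hX : ∀ t, ∃ i, X t ω = Pi.single i 1 := fun t => h.chain.basis_valued t ω
  have h1 := integral_sub_integral_comp_toNNReal hX (h.chain.cadlag ω)
    (φ := fun v => Q *ᵥ v) (by fun_prop) a b
  have h2 := integral_sub_integral_comp_toNNReal hX (h.chain.cadlag ω)
    (φ := fun v => l ⬝ᵥ v) (by fun_prop) a b
  simp only [compensatedIncrement, h1, h2, Pi.sub_apply]
  push_cast
  ring

theorem norm_mul_charVec_apply_le (h : IsMMPoissonProcess μ 𝓕 Q l X N) (u : ℝ) (a : ℝ≥0)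
    (j : Fin d) (ω : Ω) :
    ‖(Complex.exp (Complex.I * u) - 1) * charVec u X N a ω j‖ ≤ 2 * 1 := by
  rw [norm_mul]
  exact mul_le_mul (norm_exp_I_sub_one_le u)
    (norm_charVec_apply_le u X N (h.chain.basis_valued a ω) j) (norm_nonneg _) zero_le_two

theorem integrable_compensatedIncrement [IsProbabilityMeasure μ] (h : IsMMPoissonProcess μ 𝓕 Q l X N) (u : ℝ) (a b : ℝ≥0) :
    Integrable (compensatedIncrement u Q l X N a b) μ := by
  refine .of_eval fun j => ?_
  rw [h.compensatedIncrement_eq u a b j]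
  exact ((h.chain.martingale.eval j).integrable_mul_increment a b (h.stronglyMeasurable_exp u a)
    fun ω => (norm_exp_I_mul_natCast u _).le).add
    (h.martingale.integrable_mul_increment a b
      ((h.stronglyMeasurable_charVec_apply u a j).const_mul _) (h.norm_mul_charVec_apply_le u a j))

theorem setIntegral_compensatedIncrement [IsProbabilityMeasure μ] (h : IsMMPoissonProcess μ 𝓕 Q l X N) (u : ℝ)
    {a b : ℝ≥0} (hab : a ≤ b) {A : Set Ω} (hA : MeasurableSet[𝓕 a] A) :
    ∫ ω in A, compensatedIncrement u Q l X N a b ω ∂μ = 0 := by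
  ext j
  rw [eval_integral fun i => ((h.integrable_compensatedIncrement u a b).eval i).integrableOn,
    h.compensatedIncrement_eq u a b j, integral_add
    ((h.chain.martingale.eval j).integrable_mul_increment a b (h.stronglyMeasurable_exp u a)
      fun ω => (norm_exp_I_mul_natCast u _).le).integrableOn
    (h.martingale.integrable_mul_increment a b
      ((h.stronglyMeasurable_charVec_apply u a j).const_mul _)
      (h.norm_mul_charVec_apply_le u a j)).integrableOn,
    (h.chain.martingale.eval j).setIntegral_mul_increment hab (h.stronglyMeasurable_exp u a)
      (fun ω => (norm_exp_I_mul_natCast u _).le) hA,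
    h.martingale.setIntegral_mul_increment hab
      ((h.stronglyMeasurable_charVec_apply u a j).const_mul _)
      (h.norm_mul_charVec_apply_le u a j) hA]
  simp

theorem expansionError_eq (h : IsMMPoissonProcess μ 𝓕 Q l X N) (u : ℝ) (a b : ℝ≥0) (ω : Ω) :
    expansionError u Q l X N a b ω = charVec u X N b ω - charVec u X N a ω -
      (((b : ℝ) - a : ℝ) : ℂ) • (charGenerator u Q l *ᵥ charVec u X N a ω) -
        compensatedIncrement u Q l X N a b ω := by
  rw [charVec_sub_eq u Q l X N (h.chain.basis_valued a ω), expansionError]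
  abel

theorem integrable_expansionError [IsProbabilityMeasure μ] (h : IsMMPoissonProcess μ 𝓕 Q l X N) (u : ℝ) (a b : ℝ≥0) :
    Integrable (expansionError u Q l X N a b) μ := by
  have hG : Integrable (fun ω => (((b : ℝ) - a : ℝ) : ℂ) •
      (charGenerator u Q l *ᵥ charVec u X N a ω)) μ :=
    ((h.integrable_charVec u a).mulVec (charGenerator u Q l)).smul (((b : ℝ) - a : ℝ) : ℂ)
  exact ((((h.integrable_charVec u b).sub (h.integrable_charVec u a)).sub hG).sub
    (h.integrable_compensatedIncrement u a b)).congr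
    (Eventually.of_forall fun ω => (h.expansionError_eq u a b ω).symm)

theorem setIntegral_charVec_sub [IsProbabilityMeasure μ] (h : IsMMPoissonProcess μ 𝓕 Q l X N)
    (u : ℝ) {a b : ℝ≥0} (hab : a ≤ b) {A : Set Ω} (hA : MeasurableSet[𝓕 a] A) :
    ∫ ω in A, charVec u X N b ω ∂μ - ∫ ω in A, charVec u X N a ω ∂μ -
      (((b : ℝ) - a : ℝ) : ℂ) • (charGenerator u Q l *ᵥ ∫ ω in A, charVec u X N a ω ∂μ) =
    ∫ ω in A, expansionError u Q l X N a b ω ∂μ := by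
  have hG : Integrable (fun ω => (((b : ℝ) - a : ℝ) : ℂ) •
      (charGenerator u Q l *ᵥ charVec u X N a ω)) μ :=
    ((h.integrable_charVec u a).mulVec (charGenerator u Q l)).smul (((b : ℝ) - a : ℝ) : ℂ)
  have hZ : Integrable (fun ω => charVec u X N b ω - charVec u X N a ω) μ :=
    (h.integrable_charVec u b).sub (h.integrable_charVec u a)
  have hZG : Integrable (fun ω => charVec u X N b ω - charVec u X N a ω -
      (((b : ℝ) - a : ℝ) : ℂ) • (charGenerator u Q l *ᵥ charVec u X N a ω)) μ := hZ.sub hG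
  simp_rw [h.expansionError_eq u a b]
  rw [integral_sub hZG.integrableOn (h.integrable_compensatedIncrement u a b).integrableOn,
    h.setIntegral_compensatedIncrement u hab hA, sub_zero,
    integral_sub hZ.integrableOn hG.integrableOn,
    integral_sub (h.integrable_charVec u b).integrableOn (h.integrable_charVec u a).integrableOn,
    integral_smul, setIntegral_mulVec (h.integrable_charVec u a)]

theorem sum_norm_expansionError_le (h : IsMMPoissonProcess μ 𝓕 Q l X N) (u : ℝ) {s t : ℝ≥0}
    (hst : s ≤ t) (m : ℕ) (ω : Ω) :
    ∑ k ∈ Finset.range m,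
      ‖expansionError u Q l X N (partitionPt s t m k) (partitionPt s t m (k + 1)) ω‖ ≤
    8 * (N t ω : ℝ) + 6 * rateBound Q l * t := by
  have hX : ∀ t, ∃ i, X t ω = Pi.single i 1 := fun t => h.chain.basis_valued t ω
  have hK := rateBound_nonneg Q l
  -- For `m = 0` the last partition point is `s`, not `t`, so the telescoping below does not cover
  -- this case.
  rcases eq_or_ne m 0 with rfl | hm
  · simp only [Finset.range_zero, Finset.sum_empty]
    positivity
  calc _ ≤ ∑ k ∈ Finset.range m,
        ((8 * (N (partitionPt s t m (k + 1)) ω : ℝ) +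
            6 * rateBound Q l * (partitionPt s t m (k + 1) : ℝ)) -
          (8 * (N (partitionPt s t m k) ω : ℝ) + 6 * rateBound Q l * (partitionPt s t m k : ℝ))) :=
        Finset.sum_le_sum fun k _ => (norm_expansionError_le u Q l X N hX (h.counting ω).mono
          (partitionPt_mono s t m (Nat.le_succ k))).trans_eq (by ring)
    _ = (8 * (N t ω : ℝ) + 6 * rateBound Q l * t) -
          (8 * (N s ω : ℝ) + 6 * rateBound Q l * s) := by
        rw [Finset.sum_range_sub fun k => 8 * (N (partitionPt s t m k) ω : ℝ) +
          6 * rateBound Q l * (partitionPt s t m k : ℝ), partitionPt_self hst hm, partitionPt_zero]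
    _ ≤ _ := sub_le_self _ (by positivity)

/-- Dominated convergence: the pathwise limit holds off the null set of common jumps, and the
telescoped bound is integrable and free of `m`. -/
theorem tendsto_sum_integral_norm_expansionError [IsProbabilityMeasure μ] (h : IsMMPoissonProcess μ 𝓕 Q l X N) (u : ℝ)
    {s t : ℝ≥0} (hst : s ≤ t) :
    Tendsto (fun m : ℕ => ∑ k ∈ Finset.range m,
      ∫ ω, ‖expansionError u Q l X N (partitionPt s t m k) (partitionPt s t m (k + 1)) ω‖ ∂μ)
      atTop (𝓝 0) := by
  have hint (m k : ℕ) := (h.integrable_expansionError u (partitionPt s t m k)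
    (partitionPt s t m (k + 1))).norm
  simp_rw [← integral_finsetSum _ fun k _ => hint _ k]
  rw [← integral_zero Ω ℝ (μ := μ)]
  refine tendsto_integral_of_dominated_convergence
    (fun ω => 8 * (N t ω : ℝ) + 6 * rateBound Q l * t)
    (fun m => (integrable_finsetSum _ fun k _ => hint m k).aestronglyMeasurable)
    (((h.integrable_counting t).const_mul 8).add (integrable_const _))
    (fun m => Eventually.of_forall fun ω => ?_) ?_
  · rw [Real.norm_of_nonneg (Finset.sum_nonneg fun _ _ => norm_nonneg _)]
    exact h.sum_norm_expansionError_le u hst m ω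
  · filter_upwards [h.no_common_jumps] with ω hω
    exact tendsto_sum_expansionError u Q l X N (fun t => h.chain.basis_valued t ω)
      (h.chain.cadlag ω) (h.counting ω) hω hst

theorem setIntegral_charVec [IsProbabilityMeasure μ] (h : IsMMPoissonProcess μ 𝓕 Q l X N) (u : ℝ) {s t : ℝ≥0}
    (hst : s ≤ t) {A : Set Ω} (hA : MeasurableSet[𝓕 s] A) :
    ∫ ω in A, charVec u X N t ω ∂μ =
      NormedSpace.exp ((((t : ℝ) - s : ℝ) : ℂ) • charGenerator u Q l) *ᵥ
        ∫ ω in A, charVec u X N s ω ∂μ := by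
  refine eq_exp_smul_mulVec_of_tendsto_sum (g := fun r => ∫ ω in A, charVec u X N r ω ∂μ)
    (η := fun a b => ∫ ω, ‖expansionError u Q l X N a b ω‖ ∂μ) hst
    (fun r => ?_) (fun a b hsa hab => ?_) (h.tendsto_sum_integral_norm_expansionError u hst)
  · refine (norm_setIntegral_le_of_norm_le_const (measure_lt_top μ A) fun ω _ =>
      h.norm_charVec_le u r ω).trans ?_
    rw [one_mul]
    exact measureReal_le_one
  · rw [h.setIntegral_charVec_sub u hab (𝓕.mono hsa _ hA)]
    exact (norm_integral_le_integral_norm _).trans (setIntegral_le_integral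
      (h.integrable_expansionError u a b).norm (Eventually.of_forall fun ω => norm_nonneg _))

end IsMMPoissonProcess

/-! ### Conditional expectation -/

theorem mainTheorem7 {Ω : Type*} {mΩ : MeasurableSpace Ω} (μ : Measure Ω)
    [IsProbabilityMeasure μ] (𝓕 : Filtration ℝ≥0 mΩ) {d : ℕ}
    (Q : Matrix (Fin d) (Fin d) ℝ) (l : Fin d → ℝ)
    (X : ℝ≥0 → Ω → Fin d → ℝ) (N : ℝ≥0 → Ω → ℕ)
    (h : IsMMPoissonProcess μ 𝓕 Q l X N)
    (u : ℝ) (s t : ℝ≥0) (hst : s ≤ t) :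
    Integrable (charVec u X N t) μ ∧
      μ[charVec u X N t | 𝓕 s] =ᵐ[μ]
        fun ω => NormedSpace.exp (((t : ℝ) - (s : ℝ) : ℂ) • charGenerator u Q l) *ᵥ
          charVec u X N s ω := by
  refine ⟨h.integrable_charVec u t, ?_⟩
  rw [← Complex.ofReal_sub]
  have hs := h.integrable_charVec u s
  refine (ae_eq_condExp_of_forall_setIntegral_eq (𝓕.le s) (h.integrable_charVec u t)
    (fun A _ _ => (hs.mulVec _).integrableOn) (fun A hA _ => ?_)
    ?_).symm
  · rw [setIntegral_mulVec hs, h.setIntegral_charVec u hst hA]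
  · exact ((LinearMap.toContinuousLinearMap (Matrix.mulVecLin _)).continuous.comp_stronglyMeasurable
      (h.stronglyMeasurable_charVec u s)).aestronglyMeasurable
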